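/- Let $\left[{n\atop k}\right]$ denote the (unsigned) Stirling number of the first kind, i.e. the number of ways of partitioning an $n$-element set into $k$ nonempty cycles, and let $(s)_k = s(s-1)\cdots(s-k+1)$ denote the falling factorial. For integers $\alpha,\beta\ge 1$ put $$c_{\alpha,\beta}=\sum_{k=1}^{\beta}(-1)^{\beta-k}\left[{\alpha+k\atop k}\right]\binom{\alpha+\beta}{\beta-k}.$$ Then for every complex number $s\notin\{-1,-2,-3,\ldots\}$ the series below converges absolutely, and $$\Gamma(s+1)=\frac{1}{s+1}+\sum_{\alpha=1}^{\infty}\frac{1}{\alpha+s+1}\sum_{\beta=1}^{\alpha}(s)_{\beta}\,\frac{c_{\alpha,\beta}}{(\alpha+\beta)!}.$$ -/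

import Mathlib

/-- The integer `c_{α,β} = ∑_{k=1}^{β} (-1)^{β-k} [α+k, k] C(α+β, β-k)`, where `[n, k]` is the unsigned
Stirling number of the first kind. The natural subtraction `β - k` is exact, since `k ≤ β`. -/
def gammaCoeff (α β : ℕ) : ℤ :=
  ∑ k ∈ Finset.Icc 1 β,
    (-1 : ℤ) ^ (β - k) * (Nat.stirlingFirst (α + k) k : ℤ) * (Nat.choose (α + β) (β - k) : ℤ)

/-- The falling factorial `(s)_k = s (s - 1) ⋯ (s - k + 1)` of a complex number `s`. -/
noncomputable def fallingFactorial (s : ℂ) (k : ℕ) : ℂ :=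
  ∏ j ∈ Finset.range k, (s - (j : ℂ))

/-! Put `f(u) = -log (1 - u) / u` and substitute `u = 1 - e^{-t}` in `Γ(s+1) = ∫ e^{-t} t^s dt`, so
that `t^s = u^s f(u)^s`. Expanding `f^s = ∑ p_n(s) u^n` and integrating termwise, with `∫ e^{-t}
u^{n+s} dt = 1/(n+s+1)`, gives the series for real `s > 0`. Each `p_n` (`powCoeff n`) has
nonnegative coefficients, because `u f'/f` does. Hence `|p_n(s)| ≤ p_n(R)` for `|s| ≤ R`, and the
convergent series at `R` dominates the tail at complex `s`. Convergence is then locally uniform off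
the poles, and the identity theorem extends the formula. The inner sum over `β` is `p_n(s)`: expand
`(f - 1)^b` binomially and use the Stirling generating function for the powers of `-log (1 - u)`. -/

/-- The power series of `-log (1 - u) / u`. -/
noncomputable def logQuotient : PowerSeries ℝ := PowerSeries.mk fun n => 1 / ((n : ℝ) + 1)

/-- The power series of the logarithmic derivative `u f'(u) / f(u)` of `f(u) = -log (1 - u) / u`. -/
noncomputable def logQuotientLogDeriv : PowerSeries ℝ :=
  PowerSeries.X * PowerSeries.derivative ℝ logQuotient * logQuotient⁻¹

/-- The polynomial in `s` that is the `n`-th Taylor coefficient of `(-log (1 - u) / u) ^ s`. -/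
noncomputable def powCoeff (n : ℕ) : Polynomial ℝ :=
  ∑ b ∈ Finset.range (n + 1),
    Polynomial.C (PowerSeries.coeff n ((logQuotient - 1) ^ b) / (b.factorial : ℝ)) *
      descPochhammer ℝ b

/-! ### Power series: logarithmic derivative and powers of `-log (1 - u) / u`. -/

namespace logQuotient

theorem coeff_eq (n : ℕ) : PowerSeries.coeff n logQuotient = 1 / ((n : ℝ) + 1) := by
  simp [logQuotient]

theorem constantCoeff_eq : PowerSeries.constantCoeff logQuotient = 1 := by
  rw [← PowerSeries.coeff_zero_eq_constantCoeff_apply, coeff_eq]; simp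

theorem logDeriv_mul :
    logQuotientLogDeriv * logQuotient = PowerSeries.X * PowerSeries.derivative ℝ logQuotient := by
  rw [logQuotientLogDeriv, mul_assoc, PowerSeries.inv_mul_cancel, mul_one]
  rw [constantCoeff_eq]; exact one_ne_zero

theorem coeff_X_mul_derivative (P : PowerSeries ℝ) (n : ℕ) :
    PowerSeries.coeff n (PowerSeries.X * PowerSeries.derivative ℝ P) =
      (n : ℝ) * PowerSeries.coeff n P := by
  cases n with
  | zero => simp
  | succ n => rw [PowerSeries.coeff_succ_X_mul, PowerSeries.coeff_derivative]; push_cast; ring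

theorem coeff_natCast_mul (P : PowerSeries ℝ) (m n : ℕ) :
    PowerSeries.coeff n ((m : PowerSeries ℝ) * P) = (m : ℝ) * PowerSeries.coeff n P := by
  rw [← nsmul_eq_mul, map_nsmul, nsmul_eq_mul]

theorem logDeriv_add_one_mul :
    (logQuotientLogDeriv + 1) * logQuotient = PowerSeries.mk fun _ => 1 := by
  ext n
  rw [add_mul, logDeriv_mul, one_mul, map_add, coeff_X_mul_derivative, coeff_eq,
    PowerSeries.coeff_mk]
  field_simp

theorem sum_logDeriv_add_one (n : ℕ) :
    ∑ k ∈ Finset.range (n + 1), PowerSeries.coeff k (logQuotientLogDeriv + 1) *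
      (1 / ((n - k : ℝ) + 1)) = 1 := by
  have h := congrArg (PowerSeries.coeff n) logDeriv_add_one_mul
  rw [PowerSeries.coeff_mul, PowerSeries.coeff_mk,
    Finset.Nat.sum_antidiagonal_eq_sum_range_succ_mk] at h
  refine Eq.trans (Finset.sum_congr rfl fun k hk => ?_) h
  have : k ≤ n := by simpa [Nat.lt_succ_iff] using hk
  rw [coeff_eq, Nat.cast_sub this]

/-- The weights `1/(n-k+1)` decrease with `n`. Comparing the convolution identity at `m + 1` with
that at `m`, the terms `k ≤ m` contribute at most `1`, so the last coefficient is nonnegative. -/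
theorem coeff_logDeriv_add_one_nonneg (n : ℕ) :
    0 ≤ PowerSeries.coeff n (logQuotientLogDeriv + 1) := by
  induction n using Nat.strong_induction_on with
  | _ n ih =>
    have h1 := sum_logDeriv_add_one n
    rw [Finset.sum_range_succ, sub_self, zero_add, div_one, mul_one] at h1
    cases n with
    | zero => simp only [Finset.range_zero, Finset.sum_empty, zero_add] at h1; rw [h1]; norm_num
    | succ m =>
      have h2 := sum_logDeriv_add_one m
      have h3 : ∑ k ∈ Finset.range (m + 1), PowerSeries.coeff k (logQuotientLogDeriv + 1) *
          (1 / ((((m + 1 : ℕ) : ℝ) - k) + 1)) ≤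
          ∑ k ∈ Finset.range (m + 1), PowerSeries.coeff k (logQuotientLogDeriv + 1) *
          (1 / ((m - k : ℝ) + 1)) := by
        refine Finset.sum_le_sum fun k hk => ?_
        have hk' : k < m + 1 := by simpa using hk
        have hkm : (k : ℝ) ≤ m := by exact_mod_cast Nat.lt_succ_iff.1 hk'
        refine mul_le_mul_of_nonneg_left ?_ (ih k hk')
        apply one_div_le_one_div_of_le <;> push_cast <;> linarith
      linarith

theorem coeff_logDeriv_zero : PowerSeries.coeff 0 logQuotientLogDeriv = 0 := by
  simp [logQuotientLogDeriv]

theorem coeff_logDeriv_nonneg (n : ℕ) : 0 ≤ PowerSeries.coeff n logQuotientLogDeriv := by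
  cases n with
  | zero => rw [coeff_logDeriv_zero]
  | succ n =>
    have h := coeff_logDeriv_add_one_nonneg (n + 1)
    rwa [map_add, PowerSeries.coeff_one, if_neg (Nat.succ_ne_zero n), add_zero] at h

theorem X_mul_derivative_pow (m : ℕ) :
    PowerSeries.X * PowerSeries.derivative ℝ (logQuotient ^ m) =
      (m : PowerSeries ℝ) * (logQuotientLogDeriv * logQuotient ^ m) := by
  cases m with
  | zero => simp
  | succ m =>
    rw [PowerSeries.derivative_pow, Nat.add_sub_cancel, pow_succ' logQuotient m,
      ← mul_assoc logQuotientLogDeriv, logDeriv_mul]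
    ring

theorem coeff_sub_one_pow_of_lt {n b : ℕ} (h : n < b) :
    PowerSeries.coeff n ((logQuotient - 1) ^ b) = 0 := by
  apply PowerSeries.coeff_of_lt_order
  refine lt_of_lt_of_le ?_ (PowerSeries.le_order_pow_of_constantCoeff_eq_zero b ?_)
  · exact_mod_cast h
  · simp [constantCoeff_eq]

/-- `L = -log (1 - u)` satisfies `(1 - u) L' = 1`, so `(L^{k+1})' = u (L^{k+1})' + (k+1) L^k`; on
coefficients this is the Stirling recurrence. -/
theorem coeff_pow_eq_stirlingFirst (N k : ℕ) :
    PowerSeries.coeff N ((PowerSeries.X * logQuotient) ^ k) =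
      (k.factorial : ℝ) * (Nat.stirlingFirst N k : ℝ) / (N.factorial : ℝ) := by
  have hL : (1 - PowerSeries.X) * PowerSeries.derivative ℝ (PowerSeries.X * logQuotient) = 1 := by
    have : PowerSeries.derivative ℝ (PowerSeries.X * logQuotient) = PowerSeries.mk fun _ => 1 := by
      ext n
      rw [PowerSeries.coeff_derivative, PowerSeries.coeff_succ_X_mul, coeff_eq,
        PowerSeries.coeff_mk]
      field_simp
    rw [this, mul_comm]
    exact PowerSeries.mk_one_mul_one_sub_eq_one ℝ
  induction N generalizing k with
  | zero =>
    cases k with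
    | zero => simp
    | succ k => simp [pow_succ]
  | succ N ih =>
    cases k with
    | zero => simp [PowerSeries.coeff_one]
    | succ k =>
      have h : PowerSeries.derivative ℝ ((PowerSeries.X * logQuotient) ^ (k + 1)) =
          PowerSeries.X * PowerSeries.derivative ℝ ((PowerSeries.X * logQuotient) ^ (k + 1)) +
          ((k + 1 : ℕ) : PowerSeries ℝ) * (PowerSeries.X * logQuotient) ^ k := by
        have h2 : PowerSeries.derivative ℝ ((PowerSeries.X * logQuotient) ^ (k + 1)) =
          ((k + 1 : ℕ) : PowerSeries ℝ) * (PowerSeries.X * logQuotient) ^ k *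
            PowerSeries.derivative ℝ (PowerSeries.X * logQuotient) := by
          rw [PowerSeries.derivative_pow, Nat.add_sub_cancel]
        rw [← sub_eq_iff_eq_add', ← one_sub_mul, h2]
        linear_combination
          (((k + 1 : ℕ) : PowerSeries ℝ) * (PowerSeries.X * logQuotient) ^ k) * hL
      have h' := congrArg (PowerSeries.coeff N) h
      rw [map_add, coeff_X_mul_derivative, PowerSeries.coeff_derivative, coeff_natCast_mul,
        ih, ih] at h'
      have hN : ((N : ℝ) + 1) ≠ 0 := by positivity
      have hNf : (N.factorial : ℝ) ≠ 0 := by positivity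
      rw [Nat.stirlingFirst_succ_succ, Nat.factorial_succ N]
      rw [← eq_div_iff_mul_eq hN] at h'
      rw [h', Nat.factorial_succ]
      push_cast
      field_simp

theorem coeff_pow_logQuotient (n k : ℕ) :
    PowerSeries.coeff n (logQuotient ^ k) =
      (k.factorial : ℝ) * (Nat.stirlingFirst (n + k) k : ℝ) / ((n + k).factorial : ℝ) := by
  rw [← coeff_pow_eq_stirlingFirst, mul_pow, PowerSeries.coeff_X_pow_mul]

end logQuotient

open logQuotient

/-! ### The coefficient polynomials and their generating function. -/

namespace powCoeff

theorem eval_natCast (n m : ℕ) :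
    (powCoeff n).eval (m : ℝ) = PowerSeries.coeff n (logQuotient ^ m) := by
  have h : ∀ b, PowerSeries.coeff n ((logQuotient - 1) ^ b) / (b.factorial : ℝ) *
      (descPochhammer ℝ b).eval (m : ℝ) =
      (m.choose b : ℝ) * PowerSeries.coeff n ((logQuotient - 1) ^ b) := by
    intro b
    have : (b.factorial : ℝ) ≠ 0 := by positivity
    rw [descPochhammer_eval_eq_descFactorial, Nat.descFactorial_eq_factorial_mul_choose]
    push_cast
    field_simp
  have hF : logQuotient ^ m = ∑ b ∈ Finset.range (m + 1),
      m.choose b • (logQuotient - 1) ^ b := by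
    conv_lhs => rw [← sub_add_cancel logQuotient 1, add_pow]
    simp [mul_comm]
  rw [powCoeff, Polynomial.eval_finsetSum, hF, map_sum]
  simp only [Polynomial.eval_mul, Polynomial.eval_C, h, nsmul_eq_mul, coeff_natCast_mul]
  -- Both ranges are enlarged to a common one: terms with `b > n` vanish by order, those with `b >
  -- m` by the binomial.
  rw [Finset.sum_subset (Finset.range_subset_range.2 (show n + 1 ≤ n + m + 1 by omega)),
    Finset.sum_subset (Finset.range_subset_range.2 (show m + 1 ≤ n + m + 1 by omega))]
  · intro b _ hb
    rw [Nat.choose_eq_zero_of_lt (by simpa using hb)]; simp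
  · intro b _ hb
    rw [coeff_sub_one_pow_of_lt (by simpa using hb)]; simp

theorem _root_.Polynomial.eq_of_eval_natCast {p q : Polynomial ℝ}
    (h : ∀ m : ℕ, p.eval (m : ℝ) = q.eval (m : ℝ)) : p = q := by
  refine Polynomial.eq_of_infinite_eval_eq p q ((Set.infinite_range_of_injective
    (Nat.cast_injective (R := ℝ))).mono ?_)
  rintro _ ⟨m, rfl⟩
  exact h m

/-- The coefficient form of `u (f^s)' = s (u f'/f) f^s`, checked at natural `s`. It is the recursion
that makes the coefficients nonnegative. -/
theorem natCast_mul (n : ℕ) :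
    (n : Polynomial ℝ) * powCoeff n = Polynomial.X * ∑ p ∈ Finset.HasAntidiagonal.antidiagonal n,
      Polynomial.C (PowerSeries.coeff p.1 logQuotientLogDeriv) * powCoeff p.2 := by
  refine Polynomial.eq_of_eval_natCast fun m => ?_
  have h := congrArg (PowerSeries.coeff n) (X_mul_derivative_pow m)
  rw [coeff_X_mul_derivative, coeff_natCast_mul, PowerSeries.coeff_mul] at h
  simpa [Polynomial.eval_finsetSum, eval_natCast] using h

theorem zero_eq : powCoeff 0 = 1 := by simp [powCoeff]

theorem coeff_nonneg (n k : ℕ) : 0 ≤ (powCoeff n).coeff k := by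
  induction n using Nat.strong_induction_on generalizing k with
  | _ n ih =>
    rcases Nat.eq_zero_or_pos n with rfl | hn
    · rw [zero_eq, Polynomial.coeff_one]; split_ifs <;> norm_num
    · have h := congrArg (fun p => Polynomial.coeff p k) (natCast_mul n)
      simp only [← nsmul_eq_mul, Polynomial.coeff_smul] at h
      have h0 : 0 ≤ n • (powCoeff n).coeff k := by
        rw [h]
        cases k with
        | zero => simp
        | succ k =>
          rw [Polynomial.coeff_X_mul, Polynomial.finsetSum_coeff]
          refine Finset.sum_nonneg fun p hp => ?_
          rw [Polynomial.coeff_C_mul]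
          rw [Finset.HasAntidiagonal.mem_antidiagonal] at hp
          rcases Nat.eq_zero_or_pos p.1 with h1 | h1
          · rw [h1, coeff_logDeriv_zero, zero_mul]
          · exact mul_nonneg (coeff_logDeriv_nonneg _) (ih _ (by omega) _)
      rw [nsmul_eq_mul] at h0
      exact nonneg_of_mul_nonneg_right h0 (by exact_mod_cast hn)

theorem norm_aeval_le {𝕜 : Type*} [RCLike 𝕜] (n : ℕ) {s : 𝕜} {R : ℝ} (hR : ‖s‖ ≤ R) :
    ‖Polynomial.aeval s (powCoeff n)‖ ≤ (powCoeff n).eval R := by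
  rw [Polynomial.aeval_eq_sum_range, Polynomial.eval_eq_sum_range]
  refine (norm_sum_le _ _).trans (Finset.sum_le_sum fun k _ => ?_)
  rw [norm_smul, norm_pow, Real.norm_of_nonneg (coeff_nonneg n k)]
  gcongr
  exact coeff_nonneg n k

theorem abs_eval_le (n : ℕ) {s R : ℝ} (hR : |s| ≤ R) :
    |(powCoeff n).eval s| ≤ (powCoeff n).eval R := by
  simpa using norm_aeval_le (𝕜 := ℝ) n hR

theorem eval_nonneg (n : ℕ) {s : ℝ} (hs : 0 ≤ s) : 0 ≤ (powCoeff n).eval s :=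
  (abs_nonneg _).trans (abs_eval_le n (abs_of_nonneg hs).le)

/-- From `f^{l+m} = f^l f^m`, with the two exponents freed from the integers one at a time. -/
theorem eval_add (n : ℕ) (s t : ℝ) :
    (powCoeff n).eval (s + t) =
      ∑ p ∈ Finset.HasAntidiagonal.antidiagonal n, (powCoeff p.1).eval s * (powCoeff p.2).eval t := by
  have h1 : ∀ m : ℕ, (powCoeff n).comp (Polynomial.X + Polynomial.C (m : ℝ)) =
      ∑ p ∈ Finset.HasAntidiagonal.antidiagonal n,
        powCoeff p.1 * Polynomial.C ((powCoeff p.2).eval (m : ℝ)) := by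
    intro m
    refine Polynomial.eq_of_eval_natCast fun l => ?_
    simp only [Polynomial.eval_comp, Polynomial.eval_add, Polynomial.eval_X, Polynomial.eval_C,
      Polynomial.eval_finsetSum, Polynomial.eval_mul, eval_natCast]
    rw [← Nat.cast_add, eval_natCast, pow_add, PowerSeries.coeff_mul]
  have h2 : (powCoeff n).comp (Polynomial.C s + Polynomial.X) =
      ∑ p ∈ Finset.HasAntidiagonal.antidiagonal n, Polynomial.C ((powCoeff p.1).eval s) * powCoeff p.2 := by
    refine Polynomial.eq_of_eval_natCast fun m => ?_
    have := congrArg (Polynomial.eval s) (h1 m)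
    simpa [Polynomial.eval_finsetSum, Polynomial.eval_comp] using this
  simpa [Polynomial.eval_finsetSum, Polynomial.eval_comp] using congrArg (Polynomial.eval t) h2

theorem coeff_logQuotient_sub_one_pow {n : ℕ} (hn : 0 < n) (b : ℕ) :
    PowerSeries.coeff n ((logQuotient - 1) ^ b) / (b.factorial : ℝ) =
      (gammaCoeff n b : ℝ) / ((n + b).factorial : ℝ) := by
  have h : (logQuotient - 1) ^ b = ∑ k ∈ Finset.range (b + 1),
      (((-1 : ℝ) ^ (b - k) * (b.choose k : ℝ)) • logQuotient ^ k) := by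
    rw [sub_eq_add_neg, add_pow]
    refine Finset.sum_congr rfl fun k _ => ?_
    rw [PowerSeries.smul_eq_C_mul]
    simp
    ring
  rw [h, map_sum, Finset.range_eq_Ico, Finset.sum_eq_sum_Ico_succ_bot (by omega),
    gammaCoeff, Int.cast_sum, Finset.sum_div, Finset.Ico_add_one_right_eq_Icc]
  simp only [map_smul, smul_eq_mul, pow_zero, PowerSeries.coeff_one, hn.ne', if_false, mul_zero,
    zero_add, coeff_pow_logQuotient, Finset.sum_div]
  refine Finset.sum_congr rfl fun k hk => ?_
  obtain ⟨hk1, hkb⟩ := Finset.mem_Icc.1 hk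
  have e1 : ((b.choose k : ℕ) : ℝ) = b.factorial / (k.factorial * (b - k).factorial) :=
    Nat.cast_choose ℝ hkb
  have e2 : (((n + b).choose (b - k) : ℕ) : ℝ) =
      (n + b).factorial / ((b - k).factorial * (n + k).factorial) := by
    rw [Nat.cast_choose ℝ (by omega), show n + b - (b - k) = n + k by omega]
  push_cast
  rw [e1, e2]
  have f1 : (b.factorial : ℝ) ≠ 0 := by positivity
  have f2 : (k.factorial : ℝ) ≠ 0 := by positivity
  have f3 : ((b - k).factorial : ℝ) ≠ 0 := by positivity
  have f4 : ((n + b).factorial : ℝ) ≠ 0 := by positivity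
  have f5 : ((n + k).factorial : ℝ) ≠ 0 := by positivity
  field_simp

theorem aeval_descPochhammer (s : ℂ) (b : ℕ) :
    Polynomial.aeval s (descPochhammer ℝ b) = fallingFactorial s b := by
  rw [← Polynomial.eval_map_algebraMap, descPochhammer_map, descPochhammer_eval_eq_prod_range,
    fallingFactorial]

theorem aeval_eq_sum_gammaCoeff {n : ℕ} (hn : 0 < n) (s : ℂ) :
    Polynomial.aeval s (powCoeff n) = ∑ b ∈ Finset.Icc 1 n,
      fallingFactorial s b * ((gammaCoeff n b : ℂ) / ((n + b).factorial : ℂ)) := by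
  rw [powCoeff, map_sum, Finset.range_eq_Ico, Finset.sum_eq_sum_Ico_succ_bot (by omega),
    Finset.Ico_add_one_right_eq_Icc]
  simp only [coeff_logQuotient_sub_one_pow hn, map_mul, aeval_descPochhammer, Polynomial.aeval_C]
  have : gammaCoeff n 0 = 0 := by simp [gammaCoeff]
  rw [this, Int.cast_zero, zero_div, map_zero, zero_mul, zero_add]
  refine Finset.sum_congr rfl fun b _ => ?_
  rw [mul_comm]
  simp

theorem summable_norm_eval_mul_pow (s : ℝ) {u : ℝ} (hu0 : 0 ≤ u) (hu1 : u < 1) :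
    Summable fun n => ‖(powCoeff n).eval s * u ^ n‖ := by
  have h1 : Summable fun n => ‖(powCoeff n).eval 1 * u ^ n‖ := by
    refine (summable_geometric_of_lt_one hu0 hu1).of_nonneg_of_le (fun _ => norm_nonneg _) fun n => ?_
    rw [norm_mul, norm_pow, Real.norm_of_nonneg hu0]
    refine mul_le_of_le_one_left (by positivity) ?_
    have := eval_natCast n 1
    rw [Nat.cast_one, pow_one, coeff_eq] at this
    rw [this, Real.norm_of_nonneg (by positivity), div_le_one (by positivity)]
    linarith [(Nat.cast_nonneg n : (0 : ℝ) ≤ n)]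
  -- Cauchy products with the case `s = 1` reach every positive integer, which then dominates any
  -- smaller `|s|`.
  have h2 : ∀ m : ℕ, Summable fun n => ‖(powCoeff n).eval ((m : ℝ) + 1) * u ^ n‖ := by
    intro m
    induction m with
    | zero => simpa using h1
    | succ m ih =>
      refine (summable_norm_sum_mul_antidiagonal_of_summable_norm ih h1).congr fun n => ?_
      congr 1
      symm
      rw [Nat.cast_succ, eval_add _ _ 1, Finset.sum_mul]
      refine Finset.sum_congr rfl fun p hp => ?_
      rw [← Finset.HasAntidiagonal.mem_antidiagonal.1 hp, pow_add]
      ring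
  refine (h2 ⌈|s|⌉₊).of_nonneg_of_le (fun _ => norm_nonneg _) fun n => ?_
  rw [norm_mul, norm_mul]
  refine mul_le_mul_of_nonneg_right ?_ (norm_nonneg _)
  have hR : |s| ≤ (⌈|s|⌉₊ : ℝ) + 1 := (Nat.le_ceil _).trans (by linarith)
  exact (abs_eval_le n hR).trans (le_abs_self _)

theorem summable_eval_mul_pow (s : ℝ) {u : ℝ} (hu0 : 0 ≤ u) (hu1 : u < 1) :
    Summable fun n => (powCoeff n).eval s * u ^ n :=
  (summable_norm_eval_mul_pow s hu0 hu1).of_norm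

theorem tsum_eval_add (s t : ℝ) {u : ℝ} (hu0 : 0 ≤ u) (hu1 : u < 1) :
    ∑' n, (powCoeff n).eval (s + t) * u ^ n =
      (∑' n, (powCoeff n).eval s * u ^ n) * ∑' n, (powCoeff n).eval t * u ^ n := by
  rw [tsum_mul_tsum_eq_tsum_sum_antidiagonal_of_summable_norm
    (summable_norm_eval_mul_pow s hu0 hu1) (summable_norm_eval_mul_pow t hu0 hu1)]
  refine tsum_congr fun n => ?_
  rw [eval_add, Finset.sum_mul]
  refine Finset.sum_congr rfl fun p hp => ?_
  rw [← Finset.HasAntidiagonal.mem_antidiagonal.1 hp, pow_add]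
  ring

theorem tsum_eval_zero (u : ℝ) : ∑' n, (powCoeff n).eval 0 * u ^ n = 1 := by
  have h : ∀ n, (powCoeff n).eval 0 = if n = 0 then 1 else 0 := fun n => by
    have := eval_natCast n 0
    rwa [Nat.cast_zero, pow_zero, PowerSeries.coeff_one] at this
  rw [tsum_eq_single 0 fun n hn => by rw [h, if_neg hn, zero_mul]]
  simp [h]

theorem tsum_eval_one {u : ℝ} (hu0 : 0 < u) (hu1 : u < 1) :
    ∑' n, (powCoeff n).eval 1 * u ^ n = -Real.log (1 - u) / u := by
  have h := (Real.hasSum_pow_div_log_of_abs_lt_one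
    (abs_lt.2 ⟨by linarith, hu1⟩)).div_const u
  refine (h.congr_fun ?_).tsum_eq
  intro n
  have := eval_natCast n 1
  rw [Nat.cast_one, pow_one, coeff_eq] at this
  rw [this, pow_succ]
  field_simp

/-- The sum at `s` is the square of the sum at `s / 2`, and is nonzero because its product with the
sum at `-s` is `1`. -/
theorem tsum_eval_pos (s : ℝ) {u : ℝ} (hu0 : 0 ≤ u) (hu1 : u < 1) :
    0 < ∑' n, (powCoeff n).eval s * u ^ n := by
  have h1 := tsum_eval_add (s / 2) (s / 2) hu0 hu1
  have h2 := tsum_eval_add s (-s) hu0 hu1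
  rw [add_halves] at h1
  rw [add_neg_cancel, tsum_eval_zero] at h2
  refine lt_of_le_of_ne ?_ fun h => ?_
  · rw [h1]; exact mul_self_nonneg _
  · rw [← h, zero_mul] at h2; exact one_ne_zero h2

/-- The generating function of `powCoeff` is `(-log (1 - u) / u) ^ s`. -/
theorem hasSum_eval_mul_pow (s : ℝ) {u : ℝ} (hu0 : 0 < u) (hu1 : u < 1) :
    HasSum (fun n => (powCoeff n).eval s * u ^ n) ((-Real.log (1 - u) / u) ^ s) := by
  have hpos := fun s => tsum_eval_pos s hu0.le hu1
  -- The logarithm of the sum is additive in `s`; being continuous it is linear, hence determined by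
  -- its value at `s = 1`.
  let f : ℝ →+ ℝ :=
    { toFun := fun s => Real.log (∑' n, (powCoeff n).eval s * u ^ n)
      map_zero' := by rw [tsum_eval_zero, Real.log_one]
      map_add' := fun s t => by
        rw [tsum_eval_add s t hu0.le hu1, Real.log_mul (hpos s).ne' (hpos t).ne'] }
  have hc : Continuous f := by
    refine continuous_of_continuousAt_zero f ?_
    have h : ContinuousOn (fun s : ℝ => ∑' n, (powCoeff n).eval s * u ^ n) (Set.Icc (-1) 1) := by
      refine continuousOn_tsum (fun n => ?_) (summable_norm_eval_mul_pow 1 hu0.le hu1) ?_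
      · exact ((powCoeff n).continuous.mul continuous_const).continuousOn
      · intro n x hx
        rw [norm_mul, norm_mul]
        refine mul_le_mul_of_nonneg_right ?_ (norm_nonneg _)
        exact (abs_eval_le n (abs_le.2 hx)).trans (le_abs_self _)
    exact (h.continuousAt (Icc_mem_nhds (by norm_num) (by norm_num))).log (hpos 0).ne'
  have hs : f s = s * f 1 := by
    simpa using map_real_smul f hc s 1
  have hf1 : f 1 = Real.log (-Real.log (1 - u) / u) := by
    rw [← tsum_eval_one hu0 hu1]; rfl
  have hlog : 0 < -Real.log (1 - u) / u := by
    rw [← tsum_eval_one hu0 hu1]; exact hpos 1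
  have : (-Real.log (1 - u) / u) ^ s = ∑' n, (powCoeff n).eval s * u ^ n := by
    rw [Real.rpow_def_of_pos hlog, ← hf1, mul_comm, ← hs]
    exact Real.exp_log (hpos s)
  rw [this]
  exact (summable_eval_mul_pow s hu0.le hu1).hasSum

end powCoeff

/-! ### Termwise integration for positive real `s`. -/

section Integral
open MeasureTheory Set Filter Topology

theorem integrableOn_and_integral_exp_neg_mul_rpow {a : ℝ} (ha : 0 < a) :
    IntegrableOn (fun t : ℝ => Real.exp (-t) * (1 - Real.exp (-t)) ^ a) (Ioi 0) ∧
      ∫ t in Ioi (0 : ℝ), Real.exp (-t) * (1 - Real.exp (-t)) ^ a = 1 / (a + 1) := by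
  have hd : ∀ t : ℝ, HasDerivAt (fun t : ℝ => (1 - Real.exp (-t)) ^ (a + 1) / (a + 1))
      (Real.exp (-t) * (1 - Real.exp (-t)) ^ a) t := by
    intro t
    have h1 : HasDerivAt (fun t : ℝ => 1 - Real.exp (-t)) (Real.exp (-t)) t := by
      simpa using ((hasDerivAt_neg t).exp).const_sub 1
    refine ((h1.rpow_const (p := a + 1) (Or.inr (by linarith))).div_const (a + 1)).congr_deriv ?_
    rw [add_sub_cancel_right]
    field_simp
  have hn : ∀ t ∈ Ioi (0 : ℝ), 0 ≤ Real.exp (-t) * (1 - Real.exp (-t)) ^ a := by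
    intro t ht
    have : Real.exp (-t) ≤ 1 := Real.exp_le_one_iff.2 (by simpa using (mem_Ioi.1 ht).le)
    have := sub_nonneg.2 this
    positivity
  have hl : Tendsto (fun t : ℝ => (1 - Real.exp (-t)) ^ (a + 1) / (a + 1)) atTop
      (𝓝 (1 / (a + 1))) := by
    have h1 : Tendsto (fun t : ℝ => 1 - Real.exp (-t)) atTop (𝓝 (1 - 0)) :=
      (Real.tendsto_exp_neg_atTop_nhds_zero).const_sub 1
    have h2 := (h1.rpow_const (p := a + 1) (Or.inl (by norm_num))).div_const (a + 1)
    simpa using h2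
  have hc : ContinuousWithinAt (fun t : ℝ => (1 - Real.exp (-t)) ^ (a + 1) / (a + 1)) (Ici 0) 0 :=
    (hd 0).continuousAt.continuousWithinAt
  refine ⟨integrableOn_Ioi_deriv_of_nonneg hc (fun t _ => hd t) hn hl, ?_⟩
  rw [integral_Ioi_of_hasDerivAt_of_nonneg hc (fun t _ => hd t) hn hl]
  have : a + 1 ≠ 0 := by linarith
  simp [Real.zero_rpow this]

namespace powCoeff

theorem hasSum_exp_neg_mul_rpow (s : ℝ) {t : ℝ} (ht : 0 < t) :
    HasSum (fun n : ℕ => (powCoeff n).eval s *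
      (Real.exp (-t) * (1 - Real.exp (-t)) ^ ((n : ℝ) + s))) (Real.exp (-t) * t ^ s) := by
  have h1 : Real.exp (-t) < 1 := Real.exp_lt_one_iff.2 (by linarith)
  have hu0 : 0 < 1 - Real.exp (-t) := by linarith
  have hu1 : 1 - Real.exp (-t) < 1 := by linarith [Real.exp_pos (-t)]
  have h := (hasSum_eval_mul_pow s hu0 hu1).mul_left
    (Real.exp (-t) * (1 - Real.exp (-t)) ^ s)
  rw [sub_sub_cancel, Real.log_exp, neg_neg, mul_assoc,
    ← Real.mul_rpow hu0.le (by positivity), mul_div_cancel₀ _ hu0.ne'] at h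
  refine h.congr_fun fun n => ?_
  rw [Real.rpow_add hu0, Real.rpow_natCast]
  ring

/-- The series expansion of the Gamma function at positive reals. -/
theorem hasSum_Gamma {s : ℝ} (hs : 0 < s) :
    HasSum (fun n : ℕ => (powCoeff n).eval s * (1 / ((n : ℝ) + s + 1))) (Real.Gamma (s + 1)) := by
  have hG : IntegrableOn (fun t : ℝ => Real.exp (-t) * t ^ s) (Ioi 0) := by
    simpa using Real.GammaIntegral_convergent (s := s + 1) (by linarith)
  have hGe : Real.Gamma (s + 1) = ∫ t in Ioi (0 : ℝ), Real.exp (-t) * t ^ s := by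
    rw [Real.Gamma_eq_integral (by linarith)]; simp
  have hns : ∀ n : ℕ, 0 < (n : ℝ) + s := fun n => by positivity
  have hI := fun n => (integrableOn_and_integral_exp_neg_mul_rpow (hns n)).1.const_mul
    ((powCoeff n).eval s)
  have hv : ∀ n : ℕ, ∫ t in Ioi (0 : ℝ), (powCoeff n).eval s *
      (Real.exp (-t) * (1 - Real.exp (-t)) ^ ((n : ℝ) + s)) =
      (powCoeff n).eval s * (1 / ((n : ℝ) + s + 1)) := fun n => by
    rw [integral_const_mul, (integrableOn_and_integral_exp_neg_mul_rpow (hns n)).2]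
  have hpos : ∀ (n : ℕ), ∀ t ∈ Ioi (0 : ℝ), 0 ≤ (powCoeff n).eval s *
      (Real.exp (-t) * (1 - Real.exp (-t)) ^ ((n : ℝ) + s)) := by
    intro n t ht
    have h1 : Real.exp (-t) ≤ 1 := Real.exp_le_one_iff.2 (by simpa using (mem_Ioi.1 ht).le)
    have h2 := sub_nonneg.2 h1
    have h3 := eval_nonneg n hs.le
    positivity
  -- All terms are nonnegative, so partial sums are bounded by the Gamma integral itself.
  have hsum : Summable fun n : ℕ => (powCoeff n).eval s * (1 / ((n : ℝ) + s + 1)) := by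
    refine summable_of_sum_le (c := Real.Gamma (s + 1)) (fun n => ?_) fun S => ?_
    · exact mul_nonneg (eval_nonneg n hs.le) (by positivity)
    · simp only [← hv]
      rw [← integral_finsetSum _ fun n _ => hI n, hGe]
      refine setIntegral_mono_on (integrable_finsetSum _ fun n _ => hI n) hG measurableSet_Ioi ?_
      intro t ht
      exact sum_le_hasSum S (fun n _ => hpos n t ht) (hasSum_exp_neg_mul_rpow s ht)
  have hnorm : ∀ n : ℕ, ∫ t in Ioi (0 : ℝ), ‖(powCoeff n).eval s *
      (Real.exp (-t) * (1 - Real.exp (-t)) ^ ((n : ℝ) + s))‖ =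
      (powCoeff n).eval s * (1 / ((n : ℝ) + s + 1)) := fun n => by
    rw [← hv]
    exact setIntegral_congr_fun measurableSet_Ioi fun t ht => Real.norm_of_nonneg (hpos n t ht)
  have h := hasSum_integral_of_summable_integral_norm hI (by simpa only [hnorm] using hsum)
  simp only [hv] at h
  rw [hGe, setIntegral_congr_fun measurableSet_Ioi fun t ht =>
    (hasSum_exp_neg_mul_rpow s ht).tsum_eq.symm]
  exact h

end powCoeff

end Integral

/-! ### Analytic continuation to complex `s`. -/

section Continuation
open Filter Topology

namespace powCoeff

theorem norm_term_le {R : ℝ} {s : ℂ} (hs : ‖s‖ ≤ R) {n : ℕ} (hn : 2 * R ≤ n) :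
    ‖1 / ((n : ℂ) + s + 1) * Polynomial.aeval s (powCoeff n)‖ ≤
      3 * ((powCoeff n).eval R * (1 / ((n : ℝ) + R + 1))) := by
  have hR : 0 ≤ R := (norm_nonneg _).trans hs
  have h1 : (n : ℝ) + 1 - R ≤ ‖(n : ℂ) + s + 1‖ := by
    have h := norm_sub_norm_le ((n : ℂ) + 1) (-s)
    rw [norm_neg, sub_neg_eq_add, add_right_comm] at h
    have h' : ‖(n : ℂ) + 1‖ = (n : ℝ) + 1 := by
      rw [← Nat.cast_succ, Complex.norm_natCast]; push_cast; ring
    linarith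
  -- The constant `3` works since `2R ≤ n` gives `n + R + 1 ≤ 3 (n + 1 - R)`.
  have h2 : ‖1 / ((n : ℂ) + s + 1)‖ ≤ 3 * (1 / ((n : ℝ) + R + 1)) := by
    rw [norm_div, norm_one, mul_one_div, div_le_div_iff₀ (by linarith) (by positivity)]
    linarith
  calc _ = ‖1 / ((n : ℂ) + s + 1)‖ * ‖Polynomial.aeval s (powCoeff n)‖ := norm_mul _ _
    _ ≤ 3 * (1 / ((n : ℝ) + R + 1)) * (powCoeff n).eval R :=
      mul_le_mul h2 (norm_aeval_le n hs) (norm_nonneg _) (by positivity)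
    _ = _ := by ring

theorem summable_bound {R : ℝ} (hR : 0 < R) (N : ℕ) : Summable fun n : ℕ =>
    3 * ((powCoeff (n + N)).eval R * (1 / (((n + N : ℕ) : ℝ) + R + 1))) :=
  (summable_nat_add_iff N).2 ((hasSum_Gamma hR).summable.mul_left 3)

theorem summable_term (s : ℂ) :
    Summable fun n : ℕ => 1 / ((n : ℂ) + s + 1) * Polynomial.aeval s (powCoeff n) := by
  obtain ⟨N, hN⟩ := exists_nat_ge (2 * (‖s‖ + 1))
  refine (summable_nat_add_iff N).1 (Summable.of_norm_bounded
    (summable_bound (R := ‖s‖ + 1) (by positivity) N) fun n => ?_)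
  refine norm_term_le (by linarith) (hN.trans ?_)
  exact_mod_cast Nat.le_add_left N n

theorem differentiableOn_term (n : ℕ) {U : Set ℂ} (hU : ∀ s ∈ U, (n : ℂ) + s + 1 ≠ 0) :
    DifferentiableOn ℂ
      (fun s : ℂ => 1 / ((n : ℂ) + s + 1) * Polynomial.aeval s (powCoeff n)) U := by
  refine DifferentiableOn.mul ?_ (Polynomial.differentiable_aeval _).differentiableOn
  exact (differentiableOn_const _).div (by fun_prop) hU

theorem differentiableAt_tsum {s : ℂ} (hs : ∀ n : ℕ, s ≠ -((n : ℂ) + 1)) :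
    DifferentiableAt ℂ
      (fun s : ℂ => ∑' n : ℕ, 1 / ((n : ℂ) + s + 1) * Polynomial.aeval s (powCoeff n)) s := by
  -- Past index `N ≥ 2R` the poles lie outside the ball of radius `R`; the finitely many earlier
  -- terms are treated separately, at `s` only.
  set R := ‖s‖ + 1 with hR
  obtain ⟨N, hN⟩ := exists_nat_ge (2 * R)
  have hne : ∀ (n : ℕ) (w : ℂ), w ∈ Metric.ball (0 : ℂ) R → (((n + N : ℕ) : ℂ)) + w + 1 ≠ 0 := by
    intro n w hw h
    have hw' : ‖w‖ < R := by simpa using hw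
    have h1 : ‖w‖ = ((n + N + 1 : ℕ) : ℝ) := by
      rw [show w = -((n + N + 1 : ℕ) : ℂ) by push_cast at h ⊢; linear_combination h, norm_neg,
        Complex.norm_natCast]
    have h2 : (N : ℝ) ≤ ((n + N + 1 : ℕ) : ℝ) := by exact_mod_cast (by omega : N ≤ n + N + 1)
    have h3 : 0 ≤ R := by positivity
    linarith
  have htail : DifferentiableOn ℂ (fun w : ℂ => ∑' n : ℕ,
      1 / (((n + N : ℕ) : ℂ) + w + 1) * Polynomial.aeval w (powCoeff (n + N)))
      (Metric.ball 0 R) := by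
    refine Complex.differentiableOn_tsum_of_summable_norm
      (summable_bound (R := R) (by positivity) N)
      (fun n => differentiableOn_term (n + N) (hne n)) Metric.isOpen_ball fun n w hw => ?_
    refine norm_term_le (by simpa using (Metric.mem_ball.1 hw).le) (hN.trans ?_)
    exact_mod_cast Nat.le_add_left N n
  have htail' := htail.differentiableAt (Metric.isOpen_ball.mem_nhds
    (show s ∈ Metric.ball (0 : ℂ) R by simp [hR]))
  have hhead : DifferentiableAt ℂ (fun w : ℂ => ∑ n ∈ Finset.range N,
      1 / ((n : ℂ) + w + 1) * Polynomial.aeval w (powCoeff n)) s := by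
    refine DifferentiableAt.fun_sum fun n _ => ?_
    refine DifferentiableAt.mul ?_ (Polynomial.differentiable_aeval _).differentiableAt
    refine (differentiableAt_const _).div (by fun_prop) fun h => hs n ?_
    linear_combination h
  refine (hhead.add htail').congr_of_eventuallyEq (Eventually.of_forall fun w => ?_)
  exact ((summable_term w).sum_add_tsum_nat_add N).symm

theorem tsum_ofReal {x : ℝ} (hx : 0 < x) :
    ∑' n : ℕ, 1 / ((n : ℂ) + (x : ℂ) + 1) * Polynomial.aeval (x : ℂ) (powCoeff n) =
      Complex.Gamma ((x : ℂ) + 1) := by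
  have h := (hasSum_Gamma hx).tsum_eq
  rw [← Complex.ofReal_one, ← Complex.ofReal_add, Complex.Gamma_ofReal, ← h, Complex.ofReal_tsum]
  refine tsum_congr fun n => ?_
  have : Polynomial.aeval (x : ℂ) (powCoeff n) = (((powCoeff n).eval x : ℝ) : ℂ) :=
    Polynomial.aeval_algebraMap_apply_eq_algebraMap_eval x (powCoeff n)
  rw [this]
  push_cast
  ring

/-- The poles form a closed countable set, so their complement is open and connected. Both sides are
analytic there and agree at positive reals accumulating at `1`. -/
theorem tsum_eq_Gamma {s : ℂ} (hs : ∀ n : ℕ, s ≠ -((n : ℂ) + 1)) :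
    ∑' n : ℕ, 1 / ((n : ℂ) + s + 1) * Polynomial.aeval s (powCoeff n) =
      Complex.Gamma (s + 1) := by
  set P : Set ℂ := Set.range fun n : ℕ => -((n : ℂ) + 1) with hP
  have hmem : ∀ w : ℂ, w ∈ Pᶜ ↔ ∀ n : ℕ, w ≠ -((n : ℂ) + 1) := fun w => by
    simp only [hP, Set.mem_compl_iff, Set.mem_range, not_exists, ne_eq, eq_comm]
  have hconn : IsPreconnected Pᶜ :=
    ((Set.countable_range _).isPathConnected_compl_of_one_lt_rank
      (by rw [Complex.rank_real_complex]; exact Nat.one_lt_ofNat)).isConnected.isPreconnected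
  have hclosed : IsClosed P := by
    have h : P = (fun w : ℂ => -(w + 1)) ⁻¹' (Set.range ((↑) : ℕ → ℂ)) := by
      ext w
      simp only [hP, Set.mem_range, Set.mem_preimage]
      exact exists_congr fun n =>
        ⟨fun h => by rw [← h]; ring, fun h => by linear_combination -h⟩
    rw [h]
    have hN := (Complex.isometry_ofReal.isClosedEmbedding.comp
      Nat.isClosedEmbedding_coe_real).isClosed_range
    simp only [Function.comp_def, Complex.ofReal_natCast] at hN
    exact hN.preimage (by fun_prop)
  have hopen : IsOpen Pᶜ := hclosed.isOpen_compl
  have hF := DifferentiableOn.analyticOnNhd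
    (fun w hw => (differentiableAt_tsum ((hmem w).1 hw)).differentiableWithinAt) hopen
  have hG : AnalyticOnNhd ℂ (fun w : ℂ => Complex.Gamma (w + 1)) Pᶜ := by
    refine DifferentiableOn.analyticOnNhd (fun w hw => ?_) hopen
    refine DifferentiableAt.differentiableWithinAt ?_
    refine DifferentiableAt.comp (g := Complex.Gamma) w
      (Complex.differentiableAt_Gamma _ fun m h => ?_) (by fun_prop)
    exact (hmem w).1 hw m (by linear_combination h)
  have h1 : (1 : ℂ) ∈ Pᶜ := (hmem 1).2 fun n h => by
    have := congrArg Complex.re h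
    simp at this
    linarith [(Nat.cast_nonneg n : (0 : ℝ) ≤ n)]
  refine hF.eqOn_of_preconnected_of_frequently_eq hG hconn h1 ?_ ((hmem s).2 hs)
  have ht : Tendsto (fun x : ℝ => (x : ℂ)) (𝓝[≠] 1) (𝓝[≠] 1) := by
    refine tendsto_nhdsWithin_iff.2 ⟨?_, ?_⟩
    · exact (Complex.continuous_ofReal.tendsto' 1 1 Complex.ofReal_one).mono_left
        nhdsWithin_le_nhds
    · filter_upwards [self_mem_nhdsWithin] with x hx
      simpa using hx
  have hev : ∀ᶠ x : ℝ in 𝓝[≠] 1, 0 < x := nhdsWithin_le_nhds (lt_mem_nhds one_pos)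
  exact ht.frequently (hev.mono fun x hx => tsum_ofReal hx).frequently

end powCoeff

end Continuation

theorem mainTheorem1 (s : ℂ) (hs : ∀ n : ℕ, s ≠ -((n : ℂ) + 1)) :
    (Summable fun α : ℕ+ =>
      1 / (((α : ℕ) : ℂ) + s + 1) *
        ∑ β ∈ Finset.Icc 1 (α : ℕ),
          fallingFactorial s β * ((gammaCoeff (α : ℕ) β : ℂ) / (Nat.factorial ((α : ℕ) + β) : ℂ))) ∧
    Complex.Gamma (s + 1) =
      1 / (s + 1) +
        ∑' α : ℕ+,
          1 / (((α : ℕ) : ℂ) + s + 1) *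
            ∑ β ∈ Finset.Icc 1 (α : ℕ),
              fallingFactorial s β *
                ((gammaCoeff (α : ℕ) β : ℂ) / (Nat.factorial ((α : ℕ) + β) : ℂ)) := by
  -- The value is written as a remainder plus the `n = 0` term, the shape needed to pass to a sum
  -- over `ℕ+`.
  have h : HasSum (fun n : ℕ => 1 / ((n : ℂ) + s + 1) * Polynomial.aeval s (powCoeff n))
      (Complex.Gamma (s + 1) - 1 / (s + 1) +
        1 / (((0 : ℕ) : ℂ) + s + 1) * Polynomial.aeval s (powCoeff 0)) := by
    have h0 := (powCoeff.summable_term s).hasSum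
    rw [powCoeff.tsum_eq_Gamma hs] at h0
    simpa [powCoeff.zero_eq] using h0
  have h2 := hasSum_pnat_iff.2 h
  simp only [powCoeff.aeval_eq_sum_gammaCoeff (PNat.pos _)] at h2
  exact ⟨h2.summable, by rw [h2.tsum_eq]; ring⟩
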